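/- Theorem 3.6. Let $n$ be a natural number, let $A, B, X$ be complex $n\times n$ matrices with $A$ and $B$ positive definite, and let $|||\cdot|||$ be a unitarily invariant norm on the complex $n\times n$ matrices, that is, a norm with $|||UYV|||=|||Y|||$ for every matrix $Y$ and all unitary matrices $U,V$. Let $0<\nu\le\frac12$, let $r_0=\min\{2\nu,\,1-2\nu\}$, and let $m\ge 1$ be an integer. Then $$\begin{aligned}\bigl((1-\nu)|||AX|||+\nu|||XB|||\bigr)^m \ \ge\ {}& |||A^{1-\nu}XB^{\nu}|||^m+\nu^m\bigl(|||AX|||+|||XB|||\bigr)^m\\ &-\Bigl(2\nu\,(|||AX|||\,|||XB|||)^{1/2}-r_0\bigl((|||AX|||\,|||XB|||)^{1/4}-|||AX|||^{1/2}\bigr)^2\Bigr)^m .\end{aligned}$$ Here $A^{1-\nu}$ and $B^{\nu}$ are the real powers given by the functional calculus for positive definite matrices. -/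

import Mathlib

open scoped ComplexOrder MatrixOrder

/-- A unitarily invariant norm on the complex `n × n` matrices: a seminorm over `ℂ` that vanishes
only at `0` (so a norm) and satisfies `N (U * A * V) = N A` for all unitary `U`, `V`. -/
structure IsUnitarilyInvariantNorm {n : ℕ} (N : Seminorm ℂ (Matrix (Fin n) (Fin n) ℂ)) :
    Prop where
  eq_zero_of_map_eq_zero : ∀ A : Matrix (Fin n) (Fin n) ℂ, N A = 0 → A = 0
  map_unitary_mul_mul : ∀ U ∈ Matrix.unitaryGroup (Fin n) ℂ,
    ∀ V ∈ Matrix.unitaryGroup (Fin n) ℂ, ∀ A : Matrix (Fin n) (Fin n) ℂ, N (U * A * V) = N A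

/-! Write a = |||AX||| and b = |||XB|||. Hadamard's three lines theorem, applied to the entire
function z ↦ A^(1-z) X B^z, bounds |||A^(1-ν) X B^ν||| by a^(1-ν) b^ν, which leaves an inequality
between a and b. For m = 1 this is the refined Young inequality with weight 2ν for the pair a,
√(ab). For general m, name the terms G + Q ≤ P + S, with G = a^(1-ν) b^ν and Q = ν(a + b). Since S ≤
Q ≤ P, convexity of t ↦ t^m carries the inequality to m-th powers. -/

section Scalar

/-- The refinement of Young's inequality due to Kittaneh and Manasrah. -/
theorem rpow_mul_rpow_add_min_mul_sq_le {x y μ : ℝ} (hx : 0 ≤ x) (hy : 0 ≤ y)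
    (h₀ : 0 ≤ μ) (h₁ : μ ≤ 1) :
    x ^ (1 - μ) * y ^ μ + min μ (1 - μ) * (√y - √x) ^ 2 ≤ (1 - μ) * x + μ * y := by
  have hsx := Real.sq_sqrt hx
  have hsy := Real.sq_sqrt hy
  have hxy : 0 ≤ √x * √y := by positivity
  have hpow : ∀ {s t : ℝ}, 0 ≤ s → 0 ≤ t → ∀ r : ℝ,
      (√s * √t) ^ (2 * r) = s ^ r * t ^ r := fun hs ht r ↦ by
    rw [Real.rpow_mul (by positivity), Real.rpow_two, mul_pow, Real.sq_sqrt hs, Real.sq_sqrt ht,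
      Real.mul_rpow hs ht]
  rcases le_total μ (1 - μ) with h | h
  · rw [min_eq_left h]
    -- Moving the square to the right leaves (1 - 2μ)x + 2μ√(xy), so plain Young for x and √(xy)
    -- suffices; the other case uses √(xy) and y.
    have key := Real.geom_mean_le_arith_mean2_weighted (w₁ := 1 - 2 * μ) (w₂ := 2 * μ)
      (by linarith) (by linarith) hx hxy (by ring)
    rw [hpow hx hy μ, ← mul_assoc,
      ← Real.rpow_add_of_nonneg hx (by linarith) h₀,
      show 1 - 2 * μ + μ = 1 - μ by ring] at key
    nlinarith
  · rw [min_eq_right h]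
    have key := Real.geom_mean_le_arith_mean2_weighted (w₁ := 2 * (1 - μ)) (w₂ := 2 * μ - 1)
      (by linarith) (by linarith) hxy hy (by ring)
    rw [hpow hx hy (1 - μ), mul_assoc,
      ← Real.rpow_add_of_nonneg hy (by linarith) (by linarith),
      show 1 - μ + (2 * μ - 1) = μ by ring] at key
    nlinarith

/-- For exponents `m ≥ 1`, powers preserve `G + Q ≤ P + S` when `P` and `S` are the extreme terms,
even if `S` is negative. -/
theorem pow_add_pow_le_pow_add_pow {P Q G S : ℝ} (hG : 0 ≤ G) (hQ : 0 ≤ Q) (hQP : Q ≤ P)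
    (hSQ : S ≤ Q) (h : G + Q ≤ P + S) {m : ℕ} (hm : 1 ≤ m) :
    G ^ m + Q ^ m ≤ P ^ m + S ^ m := by
  have hP : 0 ≤ P := hQ.trans hQP
  rcases le_or_gt 0 S with hS | hS
  · obtain ⟨d, rfl⟩ : ∃ d, P = Q + d := ⟨P - Q, by ring⟩
    have hd : 0 ≤ d := by linarith
    -- The increment of t^k over a step d grows with t ≥ 0, and G ≤ S + d.
    have hmono : ∀ k : ℕ, (S + d) ^ k + Q ^ k ≤ (Q + d) ^ k + S ^ k := fun k ↦ by
      induction k with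
      | zero => simp
      | succ k ih =>
        have h3 : Q ^ k ≤ (Q + d) ^ k := pow_le_pow_left₀ hQ (by linarith) k
        have h4 : S ^ k ≤ Q ^ k := by gcongr
        have h5 := mul_le_mul_of_nonneg_left ih (by linarith : 0 ≤ S + d)
        have h6 := mul_nonneg (sub_nonneg.2 hSQ) (sub_nonneg.2 h3)
        have h7 := mul_nonneg hd (sub_nonneg.2 h4)
        simp only [pow_succ]
        nlinarith
    have hGS : G ^ m ≤ (S + d) ^ m := by gcongr; linarith
    linarith [hmono m]
  -- Here G, Q and -S are nonnegative with sum at most P, so superadditivity of powers replaces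
  -- convexity.
  · have hne : m ≠ 0 := by omega
    have h1 : G ^ m + Q ^ m ≤ (G + Q) ^ m := pow_add_pow_le hG hQ hne
    have h2 : (G + Q) ^ m + (-S) ^ m ≤ (G + Q + -S) ^ m :=
      pow_add_pow_le (by positivity) (by linarith) hne
    have h3 : (G + Q + -S) ^ m ≤ P ^ m := pow_le_pow_left₀ (by linarith) (by linarith) m
    have h4 : -(-S) ^ m ≤ S ^ m := by
      rcases m.even_or_odd with he | ho
      · have : 0 ≤ S ^ m := he.pow_nonneg S
        rw [he.neg_pow]; linarith
      · rw [ho.neg_pow]; linarith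
    linarith

/-- The scalar form of the main inequality. -/
theorem rpow_mul_rpow_pow_add_le {a b ν : ℝ} (ha : 0 ≤ a) (hb : 0 ≤ b) (hν₀ : 0 ≤ ν)
    (hν₁ : ν ≤ 1 / 2) {m : ℕ} (hm : 1 ≤ m) :
    (a ^ (1 - ν) * b ^ ν) ^ m + ν ^ m * (a + b) ^ m ≤
      ((1 - ν) * a + ν * b) ^ m +
        (2 * ν * (a * b) ^ (1 / 2 : ℝ) - min (2 * ν) (1 - 2 * ν) *
          ((a * b) ^ (1 / 4 : ℝ) - a ^ (1 / 2 : ℝ)) ^ 2) ^ m := by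
  have hab : 0 ≤ a * b := by positivity
  have hq : (a * b) ^ (1 / 4 : ℝ) = √√(a * b) := by
    rw [Real.sqrt_eq_rpow, Real.sqrt_eq_rpow, ← Real.rpow_mul hab]; norm_num
  rw [← mul_pow, hq, ← Real.sqrt_eq_rpow, ← Real.sqrt_eq_rpow]
  have hY := rpow_mul_rpow_add_min_mul_sq_le (μ := 2 * ν) ha (Real.sqrt_nonneg (a * b))
    (by linarith) (by linarith)
  have hg : a ^ (1 - 2 * ν) * √(a * b) ^ (2 * ν) = a ^ (1 - ν) * b ^ ν := by
    rw [Real.rpow_mul (Real.sqrt_nonneg _), Real.rpow_two, Real.sq_sqrt hab,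
      Real.mul_rpow ha hb, ← mul_assoc, ← Real.rpow_add_of_nonneg ha (by linarith) hν₀]
    ring_nf
  have hmin : 0 ≤ min (2 * ν) (1 - 2 * ν) := le_min (by linarith) (by linarith)
  have hr := mul_nonneg hmin (sq_nonneg (√√(a * b) - √a))
  have hamgm : 2 * √(a * b) ≤ a + b := by
    rw [Real.sqrt_mul ha]
    nlinarith [sq_nonneg (√a - √b), Real.sq_sqrt ha, Real.sq_sqrt hb]
  refine pow_add_pow_le_pow_add_pow (by positivity) (by positivity) ?_ ?_ ?_ hm
  · nlinarith
  · nlinarith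
  · rw [hg] at hY; linarith

end Scalar

section ThreeLines

open Complex Complex.HadamardThreeLines

/-- Hadamard's three lines theorem for an exponential sum with real frequencies and coefficients in
a normed space. -/
theorem norm_sum_exp_smul_le_interp {E ι : Type*} [NormedAddCommGroup E] [NormedSpace ℂ E]
    (s : Finset ι) (c d : ι → ℝ) (v : ι → E) {a b : ℝ}
    (ha : ∀ z : ℂ, z.re = 0 → ‖∑ i ∈ s, exp (z * c i + d i) • v i‖ ≤ a)
    (hb : ∀ z : ℂ, z.re = 1 → ‖∑ i ∈ s, exp (z * c i + d i) • v i‖ ≤ b)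
    {θ : ℝ} (h₀ : 0 ≤ θ) (h₁ : θ ≤ 1) :
    ‖∑ i ∈ s, exp (θ * c i + d i) • v i‖ ≤ a ^ (1 - θ) * b ^ θ := by
  have key := norm_le_interp_of_mem_verticalClosedStrip₀₁'
    (fun z : ℂ ↦ ∑ i ∈ s, exp (z * c i + d i) • v i) (z := (θ : ℂ)) (a := a) (b := b)
    (by simp [verticalClosedStrip, h₀, h₁]) (Differentiable.diffContOnCl (by fun_prop)) ?_
    (fun z hz ↦ ha z hz) (fun z hz ↦ hb z hz)
  · simpa using key
  · refine ⟨∑ i ∈ s, Real.exp (|c i| + d i) * ‖v i‖, ?_⟩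
    rintro _ ⟨z, hz, rfl⟩
    have hz' : 0 ≤ z.re ∧ z.re ≤ 1 := hz
    refine (norm_sum_le _ _).trans (Finset.sum_le_sum fun i _ ↦ ?_)
    rw [norm_smul, norm_exp]
    gcongr
    have : z.re * c i ≤ |c i| := by
      nlinarith [le_abs_self (c i), abs_nonneg (c i)]
    simpa using this

/-- `norm_sum_exp_smul_le_interp` for a norm given as a definite seminorm. -/
theorem Seminorm.sum_exp_smul_le_interp {E ι : Type*} [AddCommGroup E] [Module ℂ E]
    (p : Seminorm ℂ E) (hp : ∀ x, p x = 0 → x = 0)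
    (s : Finset ι) (c d : ι → ℝ) (v : ι → E) {a b : ℝ}
    (ha : ∀ z : ℂ, z.re = 0 → p (∑ i ∈ s, exp (z * c i + d i) • v i) ≤ a)
    (hb : ∀ z : ℂ, z.re = 1 → p (∑ i ∈ s, exp (z * c i + d i) • v i) ≤ b)
    {θ : ℝ} (h₀ : 0 ≤ θ) (h₁ : θ ≤ 1) :
    p (∑ i ∈ s, exp (θ * c i + d i) • v i) ≤ a ^ (1 - θ) * b ^ θ := by
  let : Norm E := ⟨p⟩
  have core : NormedSpace.Core ℂ E :=
    { norm_nonneg := apply_nonneg p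
      norm_smul := map_smul_eq_mul p
      norm_triangle := map_add_le_add p
      norm_eq_zero_iff := fun x ↦ ⟨hp x, fun h ↦ by rw [h]; exact map_zero p⟩ }
  let : NormedAddCommGroup E := NormedAddCommGroup.ofCore core
  let : NormedSpace ℂ E := NormedSpace.ofCore core
  exact norm_sum_exp_smul_le_interp s c d v ha hb h₀ h₁

end ThreeLines

section UnitarilyInvariant

open Matrix Complex

variable {n : ℕ} {N : Seminorm ℂ (Matrix (Fin n) (Fin n) ℂ)}

/-- On the edges of the strip, this makes the oscillating factors invisible to the norm. -/
theorem diagonal_exp_mem_unitaryGroup {w : Fin n → ℂ} (hw : ∀ i, (w i).re = 0) :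
    diagonal (fun i ↦ exp (w i)) ∈ unitaryGroup (Fin n) ℂ := by
  rw [mem_unitaryGroup_iff, star_eq_conjTranspose, diagonal_conjTranspose, diagonal_mul_diagonal,
    ← diagonal_one]
  congr 1
  ext i
  have hre := hw i
  have hc : star (exp (w i)) = exp (-w i) := by
    rw [star_def, ← exp_conj]
    congr 1
    apply Complex.ext <;> simp [hre]
  simp [Pi.star_apply, hc, ← exp_add]

/-- The interpolation inequality for diagonal positive definite matrices. -/
theorem IsUnitarilyInvariantNorm.diagonal_interp (hN : IsUnitarilyInvariantNorm N)
    (c d : Fin n → ℝ) (Y : Matrix (Fin n) (Fin n) ℂ) {θ : ℝ} (h₀ : 0 ≤ θ) (h₁ : θ ≤ 1) :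
    N (diagonal (fun i ↦ exp ((1 - θ) * c i)) * Y * diagonal (fun j ↦ exp (θ * d j))) ≤
      N (diagonal (fun i ↦ exp (c i)) * Y) ^ (1 - θ) *
        N (Y * diagonal (fun j ↦ exp (d j))) ^ θ := by
  -- Entrywise, the matrix function is an exponential sum with frequencies d_j - c_i.
  have hsum : ∀ z : ℂ, ∑ q : Fin n × Fin n, exp (z * (d q.2 - c q.1 : ℝ) + c q.1) •
      single q.1 q.2 (Y q.1 q.2) =
      diagonal (fun i ↦ exp ((1 - z) * c i)) * Y * diagonal (fun j ↦ exp (z * d j)) := by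
    intro z
    ext i j
    rw [mul_diagonal, diagonal_mul, Matrix.sum_apply, Fintype.sum_prod_type,
      Finset.sum_eq_single i, Finset.sum_eq_single j]
    · simp only [Matrix.smul_apply, single_apply_same, smul_eq_mul]
      rw [mul_right_comm, ← exp_add]
      congr 2
      push_cast
      ring
    · intro k _ hk
      simp [hk]
    · simp
    · intro k _ hk
      simp [hk]
    · simp
  rw [← hsum]
  refine N.sum_exp_smul_le_interp hN.eq_zero_of_map_eq_zero Finset.univ _ _ _ ?_ ?_ h₀ h₁
  · intro z hz
    rw [hsum]
    refine le_of_eq ?_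
    rw [← hN.map_unitary_mul_mul _ (diagonal_exp_mem_unitaryGroup (w := fun i ↦ -z * c i)
        (by simp [hz])) _ (diagonal_exp_mem_unitaryGroup (w := fun j ↦ z * d j) (by simp [hz]))
        (diagonal (fun i ↦ exp (c i)) * Y), ← mul_assoc, diagonal_mul_diagonal]
    congr 5
    ext i
    rw [← exp_add]
    ring_nf
  · intro z hz
    rw [hsum]
    refine le_of_eq ?_
    -- On Re z = 1 both (1 - z)c and (z - 1)d are imaginary; splitting e^(zd) = e^d e^((z-1)d)
    -- leaves only e^d.
    rw [← hN.map_unitary_mul_mul _ (diagonal_exp_mem_unitaryGroup (w := fun i ↦ (1 - z) * c i)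
        (by simp [hz])) _ (diagonal_exp_mem_unitaryGroup (w := fun j ↦ (z - 1) * d j)
        (by simp [hz])) (Y * diagonal (fun j ↦ exp (d j))), mul_assoc, mul_assoc, mul_assoc,
        diagonal_mul_diagonal]
    congr 5
    ext i
    rw [← exp_add]
    ring_nf

/-- A unitary diagonalisation of a positive definite matrix, together with its real powers. -/
theorem Matrix.PosDef.exists_unitary_diagonal_exp {A : Matrix (Fin n) (Fin n) ℂ} (hA : A.PosDef) :
    ∃ U ∈ unitaryGroup (Fin n) ℂ, ∃ c : Fin n → ℝ,
      A = U * diagonal (fun i ↦ exp (c i)) * star U ∧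
      ∀ s : ℝ, CFC.rpow A s = U * diagonal (fun i ↦ exp (s * c i)) * star U := by
  have hH := hA.isHermitian
  have hpos := hA.eigenvalues_pos
  refine ⟨hH.eigenvectorUnitary, hH.eigenvectorUnitary.2,
    fun i ↦ Real.log (hH.eigenvalues i), ?_, fun s ↦ ?_⟩
  · conv_lhs => rw [hH.spectral_theorem, Unitary.conjStarAlgAut_apply]
    congr 3
    ext i
    rw [← ofReal_exp, Real.exp_log (hpos i)]
    rfl
  · change A ^ s = _
    rw [CFC.rpow_eq_cfc_real hA.posSemidef.nonneg, hH.cfc_eq, IsHermitian.cfc,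
      Unitary.conjStarAlgAut_apply]
    congr 3
    ext i
    rw [← ofReal_mul, ← ofReal_exp, mul_comm s, ← Real.rpow_def_of_pos (hpos i)]
    rfl

/-- The interpolation inequality `|||A ^ (1 - θ) X B ^ θ||| ≤ |||A X||| ^ (1 - θ) |||X B||| ^ θ`. -/
theorem IsUnitarilyInvariantNorm.rpow_mul_mul_rpow_le (hN : IsUnitarilyInvariantNorm N)
    {A B : Matrix (Fin n) (Fin n) ℂ} (X : Matrix (Fin n) (Fin n) ℂ) (hA : A.PosDef)
    (hB : B.PosDef) {θ : ℝ} (h₀ : 0 ≤ θ) (h₁ : θ ≤ 1) :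
    N (CFC.rpow A (1 - θ) * X * CFC.rpow B θ) ≤ N (A * X) ^ (1 - θ) * N (X * B) ^ θ := by
  obtain ⟨U, hU, c, hAc, hAs⟩ := hA.exists_unitary_diagonal_exp
  obtain ⟨V, hV, d, hBd, hBs⟩ := hB.exists_unitary_diagonal_exp
  have hVs : star V ∈ unitaryGroup (Fin n) ℂ := Unitary.star_mem hV
  have hUU : U * star U = 1 := mem_unitaryGroup_iff.1 hU
  have hVV : V * star V = 1 := mem_unitaryGroup_iff.1 hV
  -- In the eigenbases of A and B, all three products involve the same matrix U*XV, and the outer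
  -- unitaries drop out of the norm.
  have e₁ : A * X = U * (diagonal (fun i ↦ exp (c i)) * (star U * X * V)) * star V := by
    conv_lhs => rw [hAc]
    simp only [mul_assoc, hVV, mul_one]
  have e₂ : X * B = U * ((star U * X * V) * diagonal (fun j ↦ exp (d j))) * star V := by
    conv_lhs => rw [hBd]
    simp only [← mul_assoc, hUU, one_mul]
  have e₃ : CFC.rpow A (1 - θ) * X * CFC.rpow B θ =
      U * (diagonal (fun i ↦ exp ((1 - θ) * c i)) * (star U * X * V) *
        diagonal (fun j ↦ exp (θ * d j))) * star V := by
    rw [hAs, hBs]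
    simp only [mul_assoc, ofReal_sub, ofReal_one]
  rw [e₁, e₂, e₃, hN.map_unitary_mul_mul U hU _ hVs, hN.map_unitary_mul_mul U hU _ hVs,
    hN.map_unitary_mul_mul U hU _ hVs]
  exact hN.diagonal_interp c d _ h₀ h₁

end UnitarilyInvariant

theorem theorem3p6 {n : ℕ} (N : Seminorm ℂ (Matrix (Fin n) (Fin n) ℂ))
    (hN : IsUnitarilyInvariantNorm N) (A B X : Matrix (Fin n) (Fin n) ℂ)
    (hA : A.PosDef) (hB : B.PosDef) (ν : ℝ) (hν₀ : 0 < ν) (hν₁ : ν ≤ 1 / 2)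
    (m : ℕ) (hm : 1 ≤ m) (r₀ : ℝ) (hr₀ : r₀ = min (2 * ν) (1 - 2 * ν)) :
    N (CFC.rpow A (1 - ν) * X * CFC.rpow B ν) ^ m + ν ^ m * (N (A * X) + N (X * B)) ^ m
        - (2 * ν * (N (A * X) * N (X * B)) ^ (1 / 2 : ℝ)
            - r₀ * ((N (A * X) * N (X * B)) ^ (1 / 4 : ℝ) - N (A * X) ^ (1 / 2 : ℝ)) ^ 2) ^ m
      ≤ ((1 - ν) * N (A * X) + ν * N (X * B)) ^ m := by
  subst hr₀
  have hle := hN.rpow_mul_mul_rpow_le X hA hB hν₀.le (by linarith : ν ≤ 1)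
  have hpow := pow_le_pow_left₀ (apply_nonneg N _) hle m
  have hscalar := rpow_mul_rpow_pow_add_le (apply_nonneg N (A * X)) (apply_nonneg N (X * B))
    hν₀.le hν₁ hm
  linarith
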